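/- For $n=1,2,3,\dots$ let $M_n$ be the algebra of complex $n\times n$ matrices with the operator norm (with respect to the Euclidean norm on $\mathbb C^n$), and let $M$ be the C*-algebra of all sequences $x=(x_n)_{n\ge 1}$ with $x_n\in M_n$ and $\|x\|=\sup_n\|x_n\|<\infty$, with componentwise operations. Let $D\subset M$ be the set of those $x\in M$ for which every $x_n$ is diagonal. Call $b\in M$ an almost permutation if, for every $n$, the matrix $b_n$ has at most one non-zero entry in each row and in each column, and each of its non-zero entries equals $1$. Let the permutation algebra $\mathcal A$ be the C*-subalgebra of $M$ generated by $D$ and the almost permutations, and let $p_B\in M$ be the projection such that, for every $n$, all entries of $(p_B)_n$ are equal to $1/n$. Theorem 3.13. $p_B\in\mathcal A$. -/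

import Mathlib

open scoped ENNReal Matrix.Norms.L2Operator

noncomputable section

namespace KadisonSinger

/-- The C*-algebra `M = ⨁ₙ Mₙ(ℂ)`, `n = 1, 2, 3, …` : bounded sequences `x = (xₙ)` of complex
`n × n` matrices with entrywise operations, each `Mₙ(ℂ)` carrying the operator norm of `ℂⁿ` with
its Euclidean norm, and `‖x‖ = supₙ ‖xₙ‖`. -/
abbrev MatrixSum : Type := lp (fun n : ℕ+ => Matrix (Fin n) (Fin n) ℂ) ∞

/-- The set `D` of all `x = (xₙ)` in `M` with every `xₙ` diagonal. -/
def diagonalElements : Set MatrixSum := {x | ∀ n : ℕ+, (x n).IsDiag}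

/-- An almost permutation: every `bₙ` has at most one non-zero entry in each row and in each
column, and the non-zero entries are equal to `1`. -/
def IsAlmostPermutation (b : MatrixSum) : Prop :=
  ∀ n : ℕ+,
    (∀ i j, b n i j ≠ 0 → b n i j = 1) ∧
    (∀ i j k, b n i j ≠ 0 → b n i k ≠ 0 → j = k) ∧
    (∀ i j k, b n i j ≠ 0 → b n k j ≠ 0 → i = k)

/-- The permutation algebra: the C*-algebra generated by `D` and the almost permutations, i.e. the
norm closure of the *-subalgebra of `M` that they generate (it has the unit of `M`, as `1 ∈ D`). -/
def permutationAlgebra : StarSubalgebra ℂ MatrixSum :=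
  (StarAlgebra.adjoin ℂ (diagonalElements ∪ {b | IsAlmostPermutation b})).topologicalClosure

/-- The `n × n` matrix all of whose entries are `1 / n`. -/
def averagingMatrix (n : ℕ+) : Matrix (Fin n) (Fin n) ℂ :=
  Matrix.of fun _ _ => 1 / ((n : ℕ) : ℂ)

theorem averagingMatrix_isStarProjection (n : ℕ+) : IsStarProjection (averagingMatrix n) := by
  constructor
  · ext i j
    have h : ((n : ℕ) : ℂ) ≠ 0 := by exact_mod_cast n.ne_zero
    simp [averagingMatrix, Matrix.mul_apply]
  · ext i j
    simp [averagingMatrix, Matrix.star_apply]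

/-- The projection `p_B` in `M`, whose `n`-th component has all entries equal to `1 / n`. -/
def pB : MatrixSum :=
  ⟨averagingMatrix, memℓp_infty ⟨1, by
    rintro _ ⟨n, rfl⟩
    exact (averagingMatrix_isStarProjection n).norm_le⟩⟩

end KadisonSinger

end

namespace KadisonSinger

/-! Expander graphs put `pB` in the algebra. On the torus `(ZMod m)²`, two shears and two unit
translations have a spectral gap independent of `m`, so powers of their lazy average converge in
norm to the projection onto constants, at a rate independent of `m`. Embed `Fin n` in a torus with
`N ≤ 4n` points. Compressing to `Fin n` and scaling by `N/n` sends the entries `1/N` to `1/n`, and a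
permutation matrix to a bounded diagonal times an almost permutation. The gap
(`sum_normSq_le_of_sum_eq_zero`) is proved on the Fourier side. Mean zero becomes vanishing at the
origin, translations become multiplication by characters, which forces concentration near the
origin, and shears stay shears. There ping-pong on quadrants excludes almost invariance under the
shears. -/

/-! ### Shears and a ping-pong inequality -/

/-- The shear `(x, y) ↦ (x + y, y)`. -/
def shearFst (R : Type*) [AddCommGroup R] : Equiv.Perm (R × R) where
  toFun z := (z.1 + z.2, z.2)
  invFun z := (z.1 - z.2, z.2)
  left_inv z := by simp
  right_inv z := by simp

/-- The shear `(x, y) ↦ (x, x + y)`. -/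
def shearSnd (R : Type*) [AddCommGroup R] : Equiv.Perm (R × R) where
  toFun z := (z.1, z.1 + z.2)
  invFun z := (z.1, z.2 - z.1)
  left_inv z := by simp
  right_inv z := by simp

/-- The weight `3/2` matters only in being below 2, the number of disjoint images in the ping-pong
argument. -/
theorem normSq_le_of_sub (u v : ℂ) : ‖u‖ ^ 2 ≤ 3 / 2 * ‖v‖ ^ 2 + 3 * ‖v - u‖ ^ 2 := by
  have h : ‖u‖ ≤ ‖v‖ + ‖v - u‖ := by
    simpa [norm_sub_rev] using norm_sub_le v (v - u)
  nlinarith [norm_nonneg u, norm_nonneg v, norm_nonneg (v - u), sq_nonneg (‖v‖ - 2 * ‖v - u‖)]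

/-- If `a` and `b` map `Q ∩ B` into disjoint subsets of `Q`, the mass of a function on `Q` is
controlled by its mass on `Q \ B` and by its variation along `a` and `b`. -/
theorem sum_normSq_le_of_pingPong {G : Type*} [Fintype G] [DecidableEq G] (a b : Equiv.Perm G)
    (Q B : Finset G) (ha : ∀ z ∈ Q ∩ B, a z ∈ Q) (hb : ∀ z ∈ Q ∩ B, b z ∈ Q)
    (hab : ∀ z ∈ Q ∩ B, ∀ w ∈ Q ∩ B, a z ≠ b w) (g : G → ℂ) :
    ∑ z ∈ Q, ‖g z‖ ^ 2 ≤ 4 * ∑ z ∈ Q \ B, ‖g z‖ ^ 2 +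
      6 * (∑ z, ‖g (a z) - g z‖ ^ 2 + ∑ z, ‖g (b z) - g z‖ ^ 2) := by
  have key (c : Equiv.Perm G) : ∑ z ∈ Q ∩ B, ‖g z‖ ^ 2 ≤
      3 / 2 * ∑ z ∈ (Q ∩ B).map c.toEmbedding, ‖g z‖ ^ 2 + 3 * ∑ z, ‖g (c z) - g z‖ ^ 2 := by
    calc ∑ z ∈ Q ∩ B, ‖g z‖ ^ 2
        ≤ ∑ z ∈ Q ∩ B, (3 / 2 * ‖g (c z)‖ ^ 2 + 3 * ‖g (c z) - g z‖ ^ 2) :=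
          Finset.sum_le_sum fun z _ => normSq_le_of_sub _ _
      _ = 3 / 2 * ∑ z ∈ (Q ∩ B).map c.toEmbedding, ‖g z‖ ^ 2 +
            3 * ∑ z ∈ Q ∩ B, ‖g (c z) - g z‖ ^ 2 := by
          simp [Finset.sum_add_distrib, Finset.mul_sum]
      _ ≤ _ := by
          gcongr
          exact Finset.subset_univ _
  have hdisj : Disjoint ((Q ∩ B).map a.toEmbedding) ((Q ∩ B).map b.toEmbedding) := by
    rw [Finset.disjoint_left]
    intro z hz hz'
    obtain ⟨u, hu, rfl⟩ := Finset.mem_map.1 hz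
    obtain ⟨v, hv, huv⟩ := Finset.mem_map.1 hz'
    exact hab u hu v hv huv.symm
  have hunion : ∑ z ∈ (Q ∩ B).map a.toEmbedding, ‖g z‖ ^ 2 +
      ∑ z ∈ (Q ∩ B).map b.toEmbedding, ‖g z‖ ^ 2 ≤ ∑ z ∈ Q, ‖g z‖ ^ 2 := by
    rw [← Finset.sum_union hdisj]
    refine Finset.sum_le_sum_of_subset_of_nonneg ?_ fun _ _ _ => by positivity
    intro z hz
    rcases Finset.mem_union.1 hz with hz | hz <;> obtain ⟨u, hu, rfl⟩ := Finset.mem_map.1 hz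
    exacts [ha u hu, hb u hu]
  have hsplit := Finset.sum_inter_add_sum_sdiff Q B fun z => ‖g z‖ ^ 2
  linarith [key a, key b]

/-! ### Ping-pong on the quadrants of the torus -/

section Torus

variable (m : ℕ) [NeZero m]

/-- The points of the torus whose least absolute representatives lie in the union of the half-open
first quadrant and its reflection in the origin. -/
def evenQuadrants : Finset (ZMod m × ZMod m) :=
  {z | (0 < z.1.valMinAbs ∧ 0 ≤ z.2.valMinAbs) ∨ (z.1.valMinAbs < 0 ∧ z.2.valMinAbs ≤ 0)}

/-- The points of the torus whose least absolute representatives lie in the union of the half-open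
second quadrant and its reflection in the origin. -/
def oddQuadrants : Finset (ZMod m × ZMod m) :=
  {z | (z.1.valMinAbs ≤ 0 ∧ 0 < z.2.valMinAbs) ∨ (0 ≤ z.1.valMinAbs ∧ z.2.valMinAbs < 0)}

/-- The points of the torus close to the origin. -/
def smallBox : Finset (ZMod m × ZMod m) :=
  {z | 4 * |z.1.valMinAbs| < m ∧ 4 * |z.2.valMinAbs| < m}

variable {m}

/-- Representatives below `m/4` in absolute value add without wrapping around. -/
theorem valMinAbs_add_of_small {x y : ZMod m} (hx : 4 * |x.valMinAbs| < m)
    (hy : 4 * |y.valMinAbs| < m) : (x + y).valMinAbs = x.valMinAbs + y.valMinAbs := by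
  rw [ZMod.valMinAbs_spec]
  refine ⟨by simp, ?_⟩
  constructor <;> cases abs_cases x.valMinAbs <;> cases abs_cases y.valMinAbs <;> omega

theorem valMinAbs_sub_of_small {x y : ZMod m} (hx : 4 * |x.valMinAbs| < m)
    (hy : 4 * |y.valMinAbs| < m) : (x - y).valMinAbs = x.valMinAbs - y.valMinAbs := by
  rw [ZMod.valMinAbs_spec]
  refine ⟨by simp, ?_⟩
  constructor <;> cases abs_cases x.valMinAbs <;> cases abs_cases y.valMinAbs <;> omega

/-- Coordinates here have no opposite signs, so the shears add absolute values. The first makes `|x|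
> |y|`, the second `|y| ≥ |x|`, hence the images are disjoint. -/
theorem sum_evenQuadrants_le (g : ZMod m × ZMod m → ℂ) :
    ∑ z ∈ evenQuadrants m, ‖g z‖ ^ 2 ≤ 4 * ∑ z ∈ evenQuadrants m \ smallBox m, ‖g z‖ ^ 2 +
      6 * (∑ z, ‖g (shearFst _ z) - g z‖ ^ 2 + ∑ z, ‖g (shearSnd _ z) - g z‖ ^ 2) := by
  apply sum_normSq_le_of_pingPong
  · rintro ⟨x, y⟩ hz
    simp only [evenQuadrants, smallBox, shearFst, Finset.mem_inter, Finset.mem_filter_univ,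
      Equiv.coe_fn_mk] at hz ⊢
    rw [valMinAbs_add_of_small hz.2.1 hz.2.2]
    omega
  · rintro ⟨x, y⟩ hz
    simp only [evenQuadrants, smallBox, shearSnd, Finset.mem_inter, Finset.mem_filter_univ,
      Equiv.coe_fn_mk] at hz ⊢
    rw [valMinAbs_add_of_small hz.2.1 hz.2.2]
    omega
  · rintro ⟨x, y⟩ hz ⟨x', y'⟩ hz' h
    simp only [evenQuadrants, smallBox, shearFst, shearSnd, Finset.mem_inter,
      Finset.mem_filter_univ, Equiv.coe_fn_mk, Prod.mk.injEq] at hz hz' h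
    have h1 := valMinAbs_add_of_small hz.2.1 hz.2.2
    have h2 := valMinAbs_add_of_small hz'.2.1 hz'.2.2
    rw [h.1] at h1
    rw [← h.2] at h2
    omega

/-- With opposite signs it is the inverse shears that add absolute values. -/
theorem sum_oddQuadrants_le (g : ZMod m × ZMod m → ℂ) :
    ∑ z ∈ oddQuadrants m, ‖g z‖ ^ 2 ≤ 4 * ∑ z ∈ oddQuadrants m \ smallBox m, ‖g z‖ ^ 2 +
      6 * (∑ z, ‖g ((shearFst _).symm z) - g z‖ ^ 2 +
        ∑ z, ‖g ((shearSnd _).symm z) - g z‖ ^ 2) := by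
  apply sum_normSq_le_of_pingPong
  · rintro ⟨x, y⟩ hz
    simp only [oddQuadrants, smallBox, shearFst, Finset.mem_inter, Finset.mem_filter_univ,
      Equiv.coe_fn_symm_mk] at hz ⊢
    rw [valMinAbs_sub_of_small hz.2.1 hz.2.2]
    omega
  · rintro ⟨x, y⟩ hz
    simp only [oddQuadrants, smallBox, shearSnd, Finset.mem_inter, Finset.mem_filter_univ,
      Equiv.coe_fn_symm_mk] at hz ⊢
    rw [valMinAbs_sub_of_small hz.2.2 hz.2.1]
    omega
  · rintro ⟨x, y⟩ hz ⟨x', y'⟩ hz' h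
    simp only [oddQuadrants, smallBox, shearFst, shearSnd, Finset.mem_inter,
      Finset.mem_filter_univ, Equiv.coe_fn_symm_mk, Prod.mk.injEq] at hz hz' h
    have h1 := valMinAbs_sub_of_small hz.2.1 hz.2.2
    have h2 := valMinAbs_sub_of_small hz'.2.2 hz'.2.1
    rw [h.1] at h1
    rw [← h.2] at h2
    omega

/-- The angle has absolute value in `[π/2, π]`, and `|exp(iθ) - 1|² = 2 - 2 cos θ`. -/
theorem one_le_norm_stdAddChar_sub_one {x : ZMod m} (hx : (m : ℤ) ≤ 4 * |x.valMinAbs|) :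
    1 ≤ ‖ZMod.stdAddChar x - 1‖ ^ 2 := by
  have hm : (0 : ℝ) < m := by exact_mod_cast Nat.pos_of_ne_zero (NeZero.ne m)
  set j := x.valMinAbs with hj
  set θ : ℝ := 2 * Real.pi * j / m with hθ
  have hexp : ZMod.stdAddChar x = Complex.exp (θ * Complex.I) := by
    rw [← ZMod.coe_valMinAbs x, ZMod.stdAddChar_coe, ← hj, hθ]
    push_cast
    congr 1
    ring
  have hj2 : 2 * |j| ≤ m := by
    have := ZMod.valMinAbs_mem_Ioc x
    rw [← hj, Set.mem_Ioc] at this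
    cases abs_cases j <;> omega
  have hcos : Real.cos θ ≤ 0 := by
    have habs : |θ| = 2 * Real.pi * |(j : ℝ)| / m := by
      rw [hθ, abs_div, abs_mul, abs_of_pos hm, abs_of_pos (by positivity : 0 < 2 * Real.pi)]
    have h1 : (m : ℝ) ≤ 4 * |(j : ℝ)| := by exact_mod_cast hx
    have h2 : 2 * |(j : ℝ)| ≤ m := by exact_mod_cast hj2
    rw [← Real.cos_abs]
    apply Real.cos_nonpos_of_pi_div_two_le_of_le
    · rw [habs, le_div_iff₀ hm]
      nlinarith [Real.pi_pos]
    · rw [habs, div_le_iff₀ hm]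
      nlinarith [Real.pi_pos]
  rw [hexp, Complex.sq_norm, Complex.normSq_apply]
  simp only [Complex.sub_re, Complex.sub_im, Complex.exp_ofReal_mul_I_re,
    Complex.exp_ofReal_mul_I_im, Complex.one_re, Complex.one_im]
  nlinarith [Real.sin_sq_add_cos_sq θ]

theorem sum_sdiff_smallBox_le (g : ZMod m × ZMod m → ℂ) :
    ∑ z ∈ Finset.univ \ smallBox m, ‖g z‖ ^ 2 ≤
      ∑ z, ‖(ZMod.stdAddChar z.1 - 1) * g z‖ ^ 2 + ∑ z, ‖(ZMod.stdAddChar z.2 - 1) * g z‖ ^ 2 := by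
  rw [← Finset.sum_add_distrib]
  refine (Finset.sum_le_sum fun z hz => ?_).trans
    (Finset.sum_le_sum_of_subset_of_nonneg (Finset.subset_univ _) fun _ _ _ => by positivity)
  simp only [smallBox, Finset.mem_sdiff, Finset.mem_univ, Finset.mem_filter_univ, true_and,
    not_and_or, not_lt] at hz
  rw [norm_mul, norm_mul, mul_pow, mul_pow]
  rcases hz with hz | hz
  · nlinarith [one_le_norm_stdAddChar_sub_one hz, sq_nonneg ‖g z‖,
      mul_nonneg (sq_nonneg ‖ZMod.stdAddChar z.2 - 1‖) (sq_nonneg ‖g z‖)]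
  · nlinarith [one_le_norm_stdAddChar_sub_one hz, sq_nonneg ‖g z‖,
      mul_nonneg (sq_nonneg ‖ZMod.stdAddChar z.1 - 1‖) (sq_nonneg ‖g z‖)]

theorem sum_symm_sub {G : Type*} [Fintype G] (c : Equiv.Perm G) (g : G → ℂ) :
    ∑ z, ‖g (c.symm z) - g z‖ ^ 2 = ∑ z, ‖g (c z) - g z‖ ^ 2 := by
  rw [← Equiv.sum_comp c]
  simp [norm_sub_rev]

/-- A function on the torus vanishing at the origin cannot be almost invariant under both shears
and concentrated near the origin. -/
theorem sum_normSq_le_of_apply_zero (g : ZMod m × ZMod m → ℂ) (hg : g 0 = 0) :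
    ∑ z, ‖g z‖ ^ 2 ≤ 12 * (∑ z, ‖g ((shearFst _).symm z) - g z‖ ^ 2 +
      ∑ z, ‖g ((shearSnd _).symm z) - g z‖ ^ 2 +
      ∑ z, ‖(ZMod.stdAddChar z.1 - 1) * g z‖ ^ 2 +
      ∑ z, ‖(ZMod.stdAddChar z.2 - 1) * g z‖ ^ 2) := by
  have hdisj : Disjoint (evenQuadrants m) (oddQuadrants m) := by
    rw [Finset.disjoint_left]
    intro z hz hz'
    simp only [evenQuadrants, oddQuadrants, Finset.mem_filter_univ] at hz hz'
    omega
  have hsum : ∑ z, ‖g z‖ ^ 2 =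
      ∑ z ∈ evenQuadrants m, ‖g z‖ ^ 2 + ∑ z ∈ oddQuadrants m, ‖g z‖ ^ 2 := by
    rw [← Finset.sum_union hdisj]
    refine (Finset.sum_subset (Finset.subset_univ _) fun z _ hz => ?_).symm
    suffices z = 0 by simp [this, hg]
    simp only [evenQuadrants, oddQuadrants, Finset.mem_union, Finset.mem_filter_univ] at hz
    ext
    · rw [Prod.fst_zero, ← ZMod.valMinAbs_eq_zero]
      omega
    · rw [Prod.snd_zero, ← ZMod.valMinAbs_eq_zero]
      omega
  have hout : ∑ z ∈ evenQuadrants m \ smallBox m, ‖g z‖ ^ 2 +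
      ∑ z ∈ oddQuadrants m \ smallBox m, ‖g z‖ ^ 2 ≤
      ∑ z ∈ Finset.univ \ smallBox m, ‖g z‖ ^ 2 := by
    rw [← Finset.sum_union (hdisj.mono Finset.sdiff_subset Finset.sdiff_subset),
      ← Finset.union_sdiff_distrib]
    exact Finset.sum_le_sum_of_subset_of_nonneg
      (Finset.sdiff_subset_sdiff (Finset.subset_univ _) le_rfl) fun _ _ _ => by positivity
  have h1 := sum_evenQuadrants_le g
  have h2 := sum_oddQuadrants_le g
  -- A permutation and its inverse have equal variation, so both quadrant bounds use the same terms.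
  rw [← sum_symm_sub (shearFst _), ← sum_symm_sub (shearSnd _)] at h1
  have h3 := sum_sdiff_smallBox_le g
  have h4 : 0 ≤ ∑ z, ‖(ZMod.stdAddChar z.1 - 1) * g z‖ ^ 2 := by positivity
  have h5 : 0 ≤ ∑ z, ‖(ZMod.stdAddChar z.2 - 1) * g z‖ ^ 2 := by positivity
  linarith

end Torus

/-! ### Fourier transform and the spectral gap -/

section Fourier

variable {m : ℕ} [NeZero m]

/-- The discrete Fourier transform on the torus. -/
noncomputable def torusDFT (f : ZMod m × ZMod m → ℂ) (k : ZMod m × ZMod m) : ℂ :=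
  ∑ z, f z * ZMod.stdAddChar (z.1 * k.1 + z.2 * k.2)

theorem sum_stdAddChar_mul (x : ZMod m) :
    ∑ k, ZMod.stdAddChar (x * k) = if x = 0 then (m : ℂ) else 0 := by
  split_ifs with h
  · simp [h, ZMod.card]
  · exact AddChar.sum_eq_zero_of_ne_one (ZMod.isPrimitive_stdAddChar m h)

theorem sum_stdAddChar_mul_add (d : ZMod m × ZMod m) :
    ∑ k : ZMod m × ZMod m, ZMod.stdAddChar (d.1 * k.1 + d.2 * k.2) =
      if d = 0 then (m : ℂ) ^ 2 else 0 := by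
  simp_rw [Fintype.sum_prod_type, AddChar.map_add_eq_mul, ← Finset.mul_sum, ← Finset.sum_mul,
    sum_stdAddChar_mul]
  by_cases h1 : d.1 = 0 <;> by_cases h2 : d.2 = 0 <;> simp [h1, h2, Prod.ext_iff, sq]

/-- Parseval, from orthogonality of characters; the transform is unnormalised, whence `m ^ 2`. -/
theorem sum_normSq_torusDFT (f : ZMod m × ZMod m → ℂ) :
    ∑ k, ‖torusDFT f k‖ ^ 2 = (m : ℝ) ^ 2 * ∑ z, ‖f z‖ ^ 2 := by
  have hterm (k : ZMod m × ZMod m) : ((‖torusDFT f k‖ ^ 2 : ℝ) : ℂ) =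
      ∑ z, ∑ w, f z * star (f w) *
        ZMod.stdAddChar ((z - w).1 * k.1 + (z - w).2 * k.2) := by
    rw [Complex.ofReal_pow, ← Complex.mul_conj', torusDFT, map_sum, Finset.sum_mul_sum]
    refine Finset.sum_congr rfl fun z _ => Finset.sum_congr rfl fun w _ => ?_
    rw [map_mul, ← AddChar.map_neg_eq_conj, mul_mul_mul_comm, ← AddChar.map_add_eq_mul]
    congr 2
    simp only [Prod.fst_sub, Prod.snd_sub]
    ring
  have : ((∑ k, ‖torusDFT f k‖ ^ 2 : ℝ) : ℂ) = ((m : ℝ) ^ 2 * ∑ z, ‖f z‖ ^ 2 : ℝ) := by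
    rw [Complex.ofReal_sum, Finset.sum_congr rfl fun k _ => hterm k, Finset.sum_comm]
    simp_rw [Finset.sum_comm (s := (Finset.univ : Finset (ZMod m × ZMod m))) (t := Finset.univ)
      (f := fun k w => _ * star (f w) * _), ← Finset.mul_sum, sum_stdAddChar_mul_add, sub_eq_zero]
    simp only [mul_ite, mul_zero, Finset.sum_ite_eq, Finset.mem_univ, if_true]
    push_cast
    rw [Finset.mul_sum]
    refine Finset.sum_congr rfl fun z _ => ?_
    rw [← Complex.mul_conj', mul_comm]
    rfl
  exact_mod_cast this

theorem torusDFT_sub (f g : ZMod m × ZMod m → ℂ) (k : ZMod m × ZMod m) :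
    torusDFT (fun z => f z - g z) k = torusDFT f k - torusDFT g k := by
  simp [torusDFT, sub_mul]

/-- The Fourier transform turns a linear map into its inverse transpose; transposition swaps the two
shears. -/
theorem torusDFT_shearFst (f : ZMod m × ZMod m → ℂ) (k : ZMod m × ZMod m) :
    torusDFT (fun z => f (shearFst _ z)) k = torusDFT f ((shearSnd _).symm k) := by
  rw [torusDFT, torusDFT, ← Equiv.sum_comp (shearFst (ZMod m)) (fun z => f z * _)]
  refine Finset.sum_congr rfl fun z _ => ?_
  congr 2
  simp only [shearFst, shearSnd, Equiv.coe_fn_mk, Equiv.coe_fn_symm_mk]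
  ring

theorem torusDFT_shearSnd (f : ZMod m × ZMod m → ℂ) (k : ZMod m × ZMod m) :
    torusDFT (fun z => f (shearSnd _ z)) k = torusDFT f ((shearFst _).symm k) := by
  rw [torusDFT, torusDFT, ← Equiv.sum_comp (shearSnd (ZMod m)) (fun z => f z * _)]
  refine Finset.sum_congr rfl fun z _ => ?_
  congr 2
  simp only [shearFst, shearSnd, Equiv.coe_fn_mk, Equiv.coe_fn_symm_mk]
  ring

theorem torusDFT_subRight (f : ZMod m × ZMod m → ℂ) (d k : ZMod m × ZMod m) :
    torusDFT (fun z => f (Equiv.subRight d z)) k =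
      ZMod.stdAddChar (d.1 * k.1 + d.2 * k.2) * torusDFT f k := by
  rw [torusDFT, torusDFT, ← Equiv.sum_comp (Equiv.subRight d) (fun z => f z * _), Finset.mul_sum]
  refine Finset.sum_congr rfl fun z _ => ?_
  rw [mul_left_comm, ← AddChar.map_add_eq_mul]
  congr 2
  simp only [Equiv.subRight_apply, Prod.fst_sub, Prod.snd_sub]
  ring

/-- The generators of the expander graphs on the torus. -/
def torusGenerator (m : ℕ) : Fin 4 → Equiv.Perm (ZMod m × ZMod m) :=
  ![shearFst _, shearSnd _, Equiv.subRight (1, 0), Equiv.subRight (0, 1)]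

/-- Spectral gap for the torus. -/
theorem sum_normSq_le_of_sum_eq_zero (f : ZMod m × ZMod m → ℂ) (hf : ∑ z, f z = 0) :
    ∑ z, ‖f z‖ ^ 2 ≤ 12 * ∑ i, ∑ z, ‖f (torusGenerator m i z) - f z‖ ^ 2 := by
  have hm : (0 : ℝ) < (m : ℝ) ^ 2 := by
    have := NeZero.ne m
    positivity
  have h := sum_normSq_le_of_apply_zero (torusDFT f) (by simpa [torusDFT] using hf)
  have hgen (c : Equiv.Perm (ZMod m × ZMod m)) :
      (m : ℝ) ^ 2 * ∑ z, ‖f (c z) - f z‖ ^ 2 =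
        ∑ k, ‖torusDFT (fun z => f (c z)) k - torusDFT f k‖ ^ 2 := by
    rw [← sum_normSq_torusDFT]
    simp_rw [torusDFT_sub]
  have h1 := hgen (shearFst _)
  have h2 := hgen (shearSnd _)
  have h3 := hgen (Equiv.subRight (1, 0))
  have h4 := hgen (Equiv.subRight (0, 1))
  simp_rw [torusDFT_shearFst] at h1
  simp_rw [torusDFT_shearSnd] at h2
  simp_rw [torusDFT_subRight, one_mul, zero_mul, add_zero, ← sub_one_mul] at h3
  simp_rw [torusDFT_subRight, one_mul, zero_mul, zero_add, ← sub_one_mul] at h4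
  rw [← h1, ← h2, ← h3, ← h4, sum_normSq_torusDFT] at h
  simp only [torusGenerator, Fin.sum_univ_four, Matrix.cons_val]
  refine le_of_mul_le_mul_left ?_ hm
  linarith

end Fourier

/-! ### Geometric convergence of the averaging operator -/

section Averaging

variable {G : Type*} [Fintype G] [DecidableEq G]

/-- The lazy averaging operator of four permutations. -/
noncomputable def averagingOperator (σ : Fin 4 → Equiv.Perm G) : Matrix G G ℂ :=
  (1 / 5 : ℂ) • (1 + ∑ i, (σ i).permMatrix ℂ)

theorem averagingOperator_mulVec (σ : Fin 4 → Equiv.Perm G) (f : G → ℂ) (z : G) :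
    (averagingOperator σ).mulVec f z = 1 / 5 * (f z + ∑ i, f (σ i z)) := by
  simp [averagingOperator, Matrix.smul_mulVec, Matrix.add_mulVec, Matrix.sum_mulVec,
    Matrix.permMatrix_mulVec, mul_add]

/-- For five numbers, `5 ∑ |xᵢ|² - |∑ xᵢ|²` is the sum of `|xᵢ - xⱼ|²` over pairs; the six pairs not
involving `x` are dropped. -/
theorem normSq_add_sum_le (x : ℂ) (y : Fin 4 → ℂ) :
    ‖x + ∑ i, y i‖ ^ 2 + ∑ i, ‖y i - x‖ ^ 2 ≤ 5 * (‖x‖ ^ 2 + ∑ i, ‖y i‖ ^ 2) := by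
  have hre : (x.re + ∑ i, (y i).re) ^ 2 + ∑ i, ((y i).re - x.re) ^ 2 ≤
      5 * (x.re ^ 2 + ∑ i, (y i).re ^ 2) := by
    simp only [Fin.sum_univ_four]
    linarith [sq_nonneg ((y 0).re - (y 1).re), sq_nonneg ((y 0).re - (y 2).re),
      sq_nonneg ((y 0).re - (y 3).re), sq_nonneg ((y 1).re - (y 2).re),
      sq_nonneg ((y 1).re - (y 3).re), sq_nonneg ((y 2).re - (y 3).re)]
  have him : (x.im + ∑ i, (y i).im) ^ 2 + ∑ i, ((y i).im - x.im) ^ 2 ≤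
      5 * (x.im ^ 2 + ∑ i, (y i).im ^ 2) := by
    simp only [Fin.sum_univ_four]
    linarith [sq_nonneg ((y 0).im - (y 1).im), sq_nonneg ((y 0).im - (y 2).im),
      sq_nonneg ((y 0).im - (y 3).im), sq_nonneg ((y 1).im - (y 2).im),
      sq_nonneg ((y 1).im - (y 3).im), sq_nonneg ((y 2).im - (y 3).im)]
  simp only [Complex.sq_norm, Complex.normSq_apply, ← sq, Complex.add_re, Complex.add_im,
    Complex.sub_re, Complex.sub_im, Complex.re_sum, Complex.im_sum, Finset.sum_add_distrib]
  linarith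

theorem sum_averagingOperator_mulVec (σ : Fin 4 → Equiv.Perm G) (f : G → ℂ) :
    ∑ z, (averagingOperator σ).mulVec f z = ∑ z, f z := by
  simp_rw [averagingOperator_mulVec, ← Finset.mul_sum, Finset.sum_add_distrib]
  rw [Finset.sum_comm]
  simp_rw [Equiv.sum_comp]
  simp only [Finset.sum_const, Finset.card_univ, Fintype.card_fin, nsmul_eq_mul]
  push_cast
  ring

/-- The variation is at least `1/12` of the mass and is lost with weight `1/25`: `1 - 1/300`. -/
theorem sum_normSq_averagingOperator_mulVec_le (σ : Fin 4 → Equiv.Perm G) {f : G → ℂ}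
    (hf : ∑ z, ‖f z‖ ^ 2 ≤ 12 * ∑ i, ∑ z, ‖f (σ i z) - f z‖ ^ 2) :
    ∑ z, ‖(averagingOperator σ).mulVec f z‖ ^ 2 ≤ 299 / 300 * ∑ z, ‖f z‖ ^ 2 := by
  have h := Finset.sum_le_sum fun z (_ : z ∈ Finset.univ) =>
    normSq_add_sum_le (f z) fun i => f (σ i z)
  simp_rw [← Finset.mul_sum, Finset.sum_add_distrib] at h
  rw [Finset.sum_comm (γ := G), Finset.sum_comm (γ := G)] at h
  simp_rw [Equiv.sum_comp (σ _) fun z => ‖f z‖ ^ 2] at h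
  simp only [Finset.sum_const, Finset.card_univ, Fintype.card_fin, nsmul_eq_mul] at h
  push_cast at h
  simp_rw [averagingOperator_mulVec, norm_mul, mul_pow, ← Finset.mul_sum]
  norm_num
  linarith

/-- If the permutations have a spectral gap on mean-zero functions, powers of the averaging operator
converge to the mean at a geometric rate. -/
theorem sum_normSq_averagingOperator_pow_sub_le (σ : Fin 4 → Equiv.Perm G)
    (hσ : ∀ f : G → ℂ, ∑ z, f z = 0 →
      ∑ z, ‖f z‖ ^ 2 ≤ 12 * ∑ i, ∑ z, ‖f (σ i z) - f z‖ ^ 2) (k : ℕ) (f : G → ℂ) :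
    ∑ z, ‖((averagingOperator σ) ^ k).mulVec f z - (∑ w, f w) / Fintype.card G‖ ^ 2 ≤
      (299 / 300) ^ k * ∑ z, ‖f z‖ ^ 2 := by
  rcases isEmpty_or_nonempty G with hG | hG
  · simp
  have hcard : (Fintype.card G : ℂ) ≠ 0 := by simp
  set c : ℂ := (∑ w, f w) / Fintype.card G with hc
  have hconst (k : ℕ) : ((averagingOperator σ) ^ k).mulVec (fun _ => c) = fun _ => c := by
    induction k with
    | zero => simp
    | succ k ih =>
      rw [pow_succ, ← Matrix.mulVec_mulVec]
      have : (averagingOperator σ).mulVec (fun _ => c) = fun _ => c := by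
        ext z
        rw [averagingOperator_mulVec]
        simp only [Finset.sum_const, Finset.card_univ, Fintype.card_fin, nsmul_eq_mul]
        push_cast
        ring
      rw [this, ih]
  have hzero (k : ℕ) (g : G → ℂ) (hg : ∑ z, g z = 0) :
      ∑ z, ((averagingOperator σ) ^ k).mulVec g z = 0 ∧
      ∑ z, ‖((averagingOperator σ) ^ k).mulVec g z‖ ^ 2 ≤ (299 / 300) ^ k * ∑ z, ‖g z‖ ^ 2 := by
    induction k with
    | zero => simpa using hg
    | succ k ih =>
      rw [pow_succ', ← Matrix.mulVec_mulVec, sum_averagingOperator_mulVec]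
      refine ⟨ih.1, (sum_normSq_averagingOperator_mulVec_le σ (hσ _ ih.1)).trans ?_⟩
      rw [pow_succ']
      linarith [ih.2]
  have hmean : ∑ z, (f z - c) = 0 := by
    rw [Finset.sum_sub_distrib, Finset.sum_const, Finset.card_univ, nsmul_eq_mul, hc,
      mul_div_cancel₀ _ hcard, sub_self]
  have hvar : ∑ z, ‖f z - c‖ ^ 2 ≤ ∑ z, ‖f z‖ ^ 2 := by
    have hpt (z : G) : ‖f z‖ ^ 2 = ‖f z - c‖ ^ 2 + ‖c‖ ^ 2 +
        2 * ((f z - c) * (starRingEnd ℂ) c).re := by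
      simp only [Complex.sq_norm, Complex.normSq_apply, Complex.mul_re, Complex.sub_re,
        Complex.sub_im, Complex.conj_re, Complex.conj_im]
      ring
    simp_rw [hpt, Finset.sum_add_distrib, ← Finset.mul_sum, ← Complex.re_sum, ← Finset.sum_mul,
      hmean]
    simp only [zero_mul, Complex.zero_re, mul_zero, add_zero, le_add_iff_nonneg_right]
    positivity
  have h := (hzero k (fun z => f z - c) hmean).2
  have hsub : (fun z => f z - c) = f - fun _ => c := rfl
  rw [hsub, Matrix.mulVec_sub, hconst] at h
  exact h.trans (by gcongr)

end Averaging

/-! ### Compression from the tori to `Mₙ` -/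

theorem l2_opNorm_le_of_forall_sum {ι : Type*} [Fintype ι] [DecidableEq ι] (A : Matrix ι ι ℂ)
    {C : ℝ} (hC : 0 ≤ C)
    (h : ∀ v : ι → ℂ, ∑ i, ‖A.mulVec v i‖ ^ 2 ≤ C ^ 2 * ∑ i, ‖v i‖ ^ 2) : ‖A‖ ≤ C := by
  rw [Matrix.l2_opNorm_def]
  refine ContinuousLinearMap.opNorm_le_bound _ hC fun x => ?_
  refine le_of_sq_le_sq ?_ (by positivity)
  rw [mul_pow, EuclideanSpace.norm_sq_eq, EuclideanSpace.norm_sq_eq]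
  exact h x.ofLp

theorem sum_normSq_extend {ι G : Type*} [Fintype ι] [Fintype G] (e : ι ↪ G) (v : ι → ℂ) :
    ∑ z, ‖Function.extend e v 0 z‖ ^ 2 = ∑ i, ‖v i‖ ^ 2 := by
  symm
  apply Fintype.sum_of_injective e e.injective
  · intro z hz
    rw [Function.extend_apply' _ _ _ hz]
    simp
  · intro i
    rw [e.injective.extend_apply]

theorem submatrix_mulVec_eq {ι G : Type*} [Fintype ι] [Fintype G] (e : ι ↪ G)
    (T : Matrix G G ℂ) (v : ι → ℂ) (i : ι) :
    (T.submatrix e e).mulVec v i = T.mulVec (Function.extend e v 0) (e i) := by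
  apply Fintype.sum_of_injective e e.injective
  · intro z hz
    rw [Function.extend_apply' _ _ _ hz]
    simp
  · intro j
    simp [e.injective.extend_apply]

theorem sum_extend {ι G : Type*} [Fintype ι] [Fintype G] (e : ι ↪ G) (v : ι → ℂ) :
    ∑ z, Function.extend e v 0 z = ∑ i, v i := by
  symm
  apply Fintype.sum_of_injective e e.injective
  · intro z hz
    rw [Function.extend_apply' _ _ _ hz]
    simp
  · intro i
    rw [e.injective.extend_apply]

theorem sum_comp_embedding_le {ι G : Type*} [Fintype ι] [Fintype G] (e : ι ↪ G) {h : G → ℝ}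
    (hh : ∀ z, 0 ≤ h z) : ∑ i, h (e i) ≤ ∑ z, h z := by
  rw [← Finset.sum_map Finset.univ e h]
  exact Finset.sum_le_sum_of_subset_of_nonneg (Finset.subset_univ _) fun z _ _ => hh z

/-- The side of a square torus with at least `n` and at most `4 n` points. -/
abbrev side (n : ℕ+) : ℕ := Nat.sqrt n + 1

/-- The square torus with at least `n` and at most `4 n` points. -/
abbrev Torus (n : ℕ+) : Type := ZMod (side n) × ZMod (side n)

theorem card_torus (n : ℕ+) : Fintype.card (Torus n) = side n ^ 2 := by
  rw [Fintype.card_prod, ZMod.card, sq]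

theorem le_card_torus (n : ℕ+) : (n : ℕ) ≤ Fintype.card (Torus n) := by
  rw [card_torus]
  exact (Nat.lt_succ_sqrt' n).le

theorem card_torus_le (n : ℕ+) : Fintype.card (Torus n) ≤ 4 * n := by
  rw [card_torus]
  have h1 : 1 ≤ Nat.sqrt n := Nat.sqrt_pos.2 n.pos
  have h2 := Nat.sqrt_le' n
  nlinarith

theorem nonempty_torusEmbedding (n : ℕ+) : Nonempty (Fin n ↪ Torus n) :=
  Function.Embedding.nonempty_of_card_le (by simpa using le_card_torus n)

/-- An embedding of the index set of `Mₙ` into the torus. -/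
noncomputable def torusEmbedding (n : ℕ+) : Fin n ↪ Torus n := (nonempty_torusEmbedding n).some

/-- The scaled compression of operators on the torus to `Mₙ`. It maps the averaging projection to
the averaging projection. -/
noncomputable def compression (n : ℕ+) (T : Matrix (Torus n) (Torus n) ℂ) :
    Matrix (Fin n) (Fin n) ℂ :=
  ((Fintype.card (Torus n) : ℂ) / (n : ℕ)) • T.submatrix (torusEmbedding n) (torusEmbedding n)

theorem norm_card_torus_div_le (n : ℕ+) : ‖(Fintype.card (Torus n) : ℂ) / (n : ℕ)‖ ≤ 4 := by
  have hn : (0 : ℝ) < (n : ℕ) := by exact_mod_cast n.pos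
  rw [norm_div, Complex.norm_natCast, Complex.norm_natCast, div_le_iff₀ hn]
  exact_mod_cast card_torus_le n

/-- The algebra of families of operators on the tori generated by families of permutations. -/
noncomputable def permutationFamilies :
    Subalgebra ℂ (∀ n : ℕ+, Matrix (Torus n) (Torus n) ℂ) :=
  Algebra.adjoin ℂ {T | ∃ σ : ∀ n : ℕ+, Equiv.Perm (Torus n), T = fun n => (σ n).permMatrix ℂ}

/-- The scaling factor depends on `n`, so it enters as an element of `D`, not as a scalar. -/
theorem exists_mem_adjoin_compression_permMatrix (σ : ∀ n : ℕ+, Equiv.Perm (Torus n)) :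
    ∃ x ∈ StarAlgebra.adjoin ℂ (diagonalElements ∪ {b | IsAlmostPermutation b}),
      ∀ n, x n = compression n ((σ n).permMatrix ℂ) := by
  let e := torusEmbedding
  let d : MatrixSum := ⟨fun n => Matrix.diagonal fun _ => (Fintype.card (Torus n) : ℂ) / (n : ℕ),
    memℓp_infty ⟨4, by
      rintro _ ⟨n, rfl⟩
      dsimp only
      rw [Matrix.l2_opNorm_diagonal]
      exact (pi_norm_le_iff_of_nonneg (by norm_num)).2 fun _ => norm_card_torus_div_le n⟩⟩
  let b : MatrixSum := ⟨fun n => ((σ n).permMatrix ℂ).submatrix (e n) (e n),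
    memℓp_infty ⟨1, by
      rintro _ ⟨n, rfl⟩
      refine l2_opNorm_le_of_forall_sum _ zero_le_one fun v => ?_
      simp_rw [submatrix_mulVec_eq, Matrix.permMatrix_mulVec]
      rw [one_pow, one_mul, ← sum_normSq_extend (e n) v,
        ← Equiv.sum_comp (σ n) fun z => ‖Function.extend (e n) v 0 z‖ ^ 2]
      exact sum_comp_embedding_le (e n)
        (h := fun z => ‖Function.extend (e n) v 0 (σ n z)‖ ^ 2) fun z => by positivity⟩⟩
  have hentry (n : ℕ+) (i j : Fin n) : b n i j = if σ n (e n i) = e n j then 1 else 0 := by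
    change (σ n).permMatrix ℂ (e n i) (e n j) = _
    simp [Equiv.Perm.permMatrix, PEquiv.toMatrix_apply, eq_comm]
  have hd : d ∈ diagonalElements := fun n => Matrix.isDiag_diagonal _
  have hb : IsAlmostPermutation b := by
    intro n
    simp only [hentry, ne_eq, ite_eq_right_iff, one_ne_zero, imp_false, not_not]
    refine ⟨fun i j h => if_pos h, fun i j k hj hk => ?_, fun i j k hi hk => ?_⟩
    · exact (e n).injective (hj.symm.trans hk)
    · exact (e n).injective ((σ n).injective (hi.trans hk.symm))
  refine ⟨d * b, mul_mem (StarAlgebra.subset_adjoin _ _ (Or.inl hd))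
    (StarAlgebra.subset_adjoin _ _ (Or.inr hb)), fun n => ?_⟩
  change d n * b n = _
  change Matrix.diagonal _ * _ = _
  rw [← Matrix.smul_eq_diagonal_mul]
  rfl

/-- Compression is linear but not multiplicative. Since permutation families are closed under
products, their algebra is just their linear span. -/
theorem exists_mem_adjoin_compression {T : ∀ n : ℕ+, Matrix (Torus n) (Torus n) ℂ}
    (hT : T ∈ permutationFamilies) :
    ∃ x ∈ StarAlgebra.adjoin ℂ (diagonalElements ∪ {b | IsAlmostPermutation b}),
      ∀ n, x n = compression n (T n) := by
  rw [permutationFamilies, ← Subalgebra.mem_toSubmodule, Algebra.adjoin_eq_span] at hT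
  induction hT using Submodule.span_induction with
  | zero => exact ⟨0, zero_mem _, fun n => by simp [compression]⟩
  | add S T _ _ hS hT =>
    obtain ⟨x, hx, hxS⟩ := hS
    obtain ⟨y, hy, hyT⟩ := hT
    refine ⟨x + y, add_mem hx hy, fun n => ?_⟩
    change x n + y n = _
    simp [hxS, hyT, compression, Matrix.submatrix_add]
  | smul c T _ hT =>
    obtain ⟨x, hx, hxT⟩ := hT
    refine ⟨c • x, SMulMemClass.smul_mem c hx, fun n => ?_⟩
    change c • x n = _
    simp [hxT, compression, Matrix.submatrix_smul, smul_comm c]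
  | mem T hT =>
    suffices ∃ σ : ∀ n : ℕ+, Equiv.Perm (Torus n), T = fun n => (σ n).permMatrix ℂ by
      obtain ⟨σ, rfl⟩ := this
      exact exists_mem_adjoin_compression_permMatrix σ
    induction hT using Submonoid.closure_induction with
    | mem T hT => exact hT
    | one => exact ⟨1, by ext1 n; simp⟩
    | mul S T _ _ hS hT =>
      obtain ⟨σ, rfl⟩ := hS
      obtain ⟨τ, rfl⟩ := hT
      -- `permMatrix` reverses products.
      exact ⟨τ * σ, by ext1 n; simp [Matrix.permMatrix_mul]⟩

/-! ### Approximation of `pB` -/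

/-- The family of averaging operators of the expanders on the tori. -/
noncomputable def torusAveraging (n : ℕ+) : Matrix (Torus n) (Torus n) ℂ :=
  averagingOperator (torusGenerator (side n))

theorem torusAveraging_mem : torusAveraging ∈ permutationFamilies := by
  have h : torusAveraging = (1 / 5 : ℂ) •
      (1 + ∑ i, fun n : ℕ+ => (torusGenerator (side n) i).permMatrix ℂ) := by
    ext1 n
    simp [torusAveraging, averagingOperator]
  rw [h]
  refine Subalgebra.smul_mem _ (add_mem (one_mem _) (sum_mem fun i _ => ?_)) _
  exact Algebra.subset_adjoin ⟨fun n => torusGenerator (side n) i, rfl⟩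

/-- Extension by zero preserves sum and norm, so the torus estimate applies; the scaling costs at
most 4, and the bound is free of `n`. -/
theorem norm_compression_sub_averagingMatrix_le (n : ℕ+) (k : ℕ) :
    ‖compression n (torusAveraging n ^ k) - averagingMatrix n‖ ≤ 4 * √((299 / 300) ^ k) := by
  refine l2_opNorm_le_of_forall_sum _ (by positivity) fun v => ?_
  set f := Function.extend (torusEmbedding n) v 0 with hf
  have hn : ((n : ℕ) : ℂ) ≠ 0 := by exact_mod_cast n.ne_zero
  have hG : (Fintype.card (Torus n) : ℂ) ≠ 0 := Nat.cast_ne_zero.2 Fintype.card_ne_zero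
  have hentry (i : Fin n) : (compression n (torusAveraging n ^ k) - averagingMatrix n).mulVec v i =
      (Fintype.card (Torus n) : ℂ) / (n : ℕ) *
        ((torusAveraging n ^ k).mulVec f (torusEmbedding n i) -
          (∑ w, f w) / Fintype.card (Torus n)) := by
    rw [Matrix.sub_mulVec, Pi.sub_apply, compression, Matrix.smul_mulVec, Pi.smul_apply,
      submatrix_mulVec_eq, ← hf, smul_eq_mul, mul_sub, hf, sum_extend]
    congr 1
    simp only [averagingMatrix, Matrix.mulVec, dotProduct, Matrix.of_apply, ← Finset.mul_sum]
    field_simp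
  simp_rw [hentry, norm_mul, mul_pow, ← Finset.mul_sum]
  rw [Real.sq_sqrt (by positivity), mul_assoc]
  gcongr
  · exact norm_card_torus_div_le n
  · refine (sum_comp_embedding_le (torusEmbedding n)
      (h := fun z => ‖(torusAveraging n ^ k).mulVec f z - _‖ ^ 2) fun z => by positivity).trans ?_
    rw [← sum_normSq_extend (torusEmbedding n) v]
    exact sum_normSq_averagingOperator_pow_sub_le _ sum_normSq_le_of_sum_eq_zero k f

end KadisonSinger

theorem theorem3p13 : KadisonSinger.pB ∈ KadisonSinger.permutationAlgebra := by
  open KadisonSinger in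
  rw [permutationAlgebra, ← SetLike.mem_coe, StarSubalgebra.topologicalClosure_coe,
    Metric.mem_closure_iff]
  intro ε hε
  have hlim : Filter.Tendsto (fun k : ℕ => 4 * √((299 / 300 : ℝ) ^ k)) Filter.atTop (nhds 0) := by
    have h := (tendsto_pow_atTop_nhds_zero_of_lt_one (r := (299 / 300 : ℝ)) (by norm_num)
      (by norm_num)).sqrt.const_mul 4
    simpa using h
  obtain ⟨k, hk⟩ := (hlim.eventually (gt_mem_nhds hε)).exists
  obtain ⟨x, hx, hxk⟩ := exists_mem_adjoin_compression (pow_mem torusAveraging_mem k)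
  refine ⟨x, hx, lt_of_le_of_lt ?_ hk⟩
  rw [dist_comm, dist_eq_norm]
  refine lp.norm_le_of_forall_le (by positivity) fun n => ?_
  change ‖x n - averagingMatrix n‖ ≤ _
  rw [hxk]
  exact norm_compression_sub_averagingMatrix_le n k
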